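/- Identify $M_2$ with the complex $2\times 2$ matrices with operator norm, with standard basis $e_1,e_2$ of $\mathbb{C}^2$ and matrix units $E_{ij}=|e_i\rangle\langle e_j|$, and let $D_2\subset M_2$ be the diagonal matrices. For a linear map $\phi:M_2\to M_2$ let $\rho_\phi=\sum_{i,j}E_{ij}\otimes\phi(E_{ij})$ be its Choi matrix. Let $\pi$ be the projective norm on $M_2\otimes M_2$, $$\pi(z)=\inf\Big\{\sum_i\|a_i\|\,\|b_i\|_1 : z=\sum_i a_i\otimes b_i\Big\}$$ ($\|\cdot\|_1$ is the trace norm), let $\alpha(\rho)=\sup_{z\ne0}|\operatorname{Tr}\rho z|/\pi(z)$ be its dual norm, and let $$\mathfrak D=\{\rho\in M_2\otimes M_2:\ \rho=\rho^*,\ \alpha(\rho)=1,\ \langle x\otimes y,\rho\,(x\otimes y)\rangle\ge0\ \ \forall x,y\in\mathbb{C}^2,\ \operatorname{Tr}\rho=2\}.$$ A linear map $\phi:M_2\to M_2$ is called a *regular extreme normalized unital map* if it is an extreme point of the convex set of positive (or of the convex set of completely positive) linear maps $\phi:M_2\to M_2$ with $\phi(1)=1$ and $\|\phi\|=1$, and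 if its restriction $\phi|_{D_2}$ is an extreme point of the convex set of unital completely positive maps $D_2\to M_2$. **Theorem.** Consider the following matrices in $M_2\otimes M_2$: 1. the symmetries in $\mathfrak D$, i.e. the $s\in\mathfrak D$ with $s=s^*$ and $s^2=1$; 2. $2P_x$, where $P_x=|x\rangle\langle x|$ and $x=\tfrac1{\sqrt2}(u_1\otimes v_1+u_2\otimes v_2)$ is maximally entangled ($u$, $v$ orthonormal bases of $\mathbb{C}^2$); 3. $p\otimes 1$, where $p$ is a rank one orthogonal projector in $M_2$; 4. $\rho_{\tilde\phi}=E_{11}\otimes|y_1\rangle\langle y_1|+E_{22}\otimes|y_2\rangle\langle y_2|$, where $\{y_1,y_2\}$ is an orthonormal basis of $\mathbb{C}^2$. All of these matrices belong to $\mathfrak D$, and for every regular extreme normalized unital map $\phi$ the Choi matrix $\rho_\phi$ is one of them. -/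

import Mathlib

open scoped Matrix Kronecker ComplexOrder MatrixOrder Matrix.Norms.L2Operator

noncomputable section

namespace RegularExtreme

/-! Throughout, `M_n` is `Matrix n n ℂ` with the operator norm of `ℂⁿ` (Euclidean), and
`M_n ⊗ M_n` is identified with `Matrix (n × n) (n × n) ℂ` through the Kronecker product. -/

variable {n m : Type} [Fintype n] [DecidableEq n] [Fintype m] [DecidableEq m]

/-- A linear map `M_n → M_m` is positive if it maps positive semidefinite matrices to positive
semidefinite matrices. -/
def IsPositiveMap (φ : Matrix n n ℂ →ₗ[ℂ] Matrix m m ℂ) : Prop :=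
  ∀ a : Matrix n n ℂ, a.PosSemidef → (φ a).PosSemidef

/-- A linear map from a unital subalgebra `S` of `M_n` to `M_m` is completely positive if for all
`k` its entrywise application to `k × k` matrices over `S` preserves positive semidefiniteness;
`Matrix.comp` turns a `k × k` matrix of `n × n` matrices into a `kn × kn` matrix. -/
def IsCompletelyPositiveOn (S : Subalgebra ℂ (Matrix n n ℂ)) (φ : S →ₗ[ℂ] Matrix m m ℂ) : Prop :=
  ∀ (k : ℕ) (A : Matrix (Fin k) (Fin k) S),
    (Matrix.comp (Fin k) (Fin k) n n ℂ (A.map fun a => (a : Matrix n n ℂ))).PosSemidef →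
      (Matrix.comp (Fin k) (Fin k) m m ℂ (A.map φ)).PosSemidef

/-- A linear map `M_n → M_m` is completely positive if for all `k` its entrywise application to
`k × k` matrices over `M_n` preserves positive semidefiniteness. -/
def IsCompletelyPositive (φ : Matrix n n ℂ →ₗ[ℂ] Matrix m m ℂ) : Prop :=
  ∀ (k : ℕ) (A : Matrix (Fin k) (Fin k) (Matrix n n ℂ)),
    (Matrix.comp (Fin k) (Fin k) n n ℂ A).PosSemidef →
      (Matrix.comp (Fin k) (Fin k) m m ℂ (A.map φ)).PosSemidef

/-- A linear map is normalized if its norm (with respect to the operator norms of matrices)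
equals one. -/
def IsNormalized (φ : Matrix n n ℂ →ₗ[ℂ] Matrix m m ℂ) : Prop :=
  ‖LinearMap.toContinuousLinearMap φ‖ = 1

variable (n) in
/-- The convex set of normalized unital positive maps on `M_n`. -/
def positiveMaps : Set (Matrix n n ℂ →ₗ[ℂ] Matrix n n ℂ) :=
  {φ | IsPositiveMap φ ∧ φ 1 = 1 ∧ IsNormalized φ}

variable (n) in
/-- The convex set of normalized unital completely positive maps on `M_n`. -/
def completelyPositiveMaps : Set (Matrix n n ℂ →ₗ[ℂ] Matrix n n ℂ) :=
  {φ | IsCompletelyPositive φ ∧ φ 1 = 1 ∧ IsNormalized φ}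

variable (n) in
/-- The algebra of diagonal `n × n` matrices. -/
def diagonalAlgebra : Subalgebra ℂ (Matrix n n ℂ) :=
  (Matrix.diagonalAlgHom ℂ : (n → ℂ) →ₐ[ℂ] Matrix n n ℂ).range

variable (n) in
/-- The convex set of unital completely positive maps from the diagonal matrices to `M_n`. -/
def diagonalMaps : Set (diagonalAlgebra n →ₗ[ℂ] Matrix n n ℂ) :=
  {φ | IsCompletelyPositiveOn (diagonalAlgebra n) φ ∧ φ 1 = 1}

/-- A regular extreme normalized unital map: an extreme point of the normalized unital positive
maps, or of the normalized unital completely positive maps, whose restriction to the diagonal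
matrices is an extreme point of the unital completely positive maps on the diagonal matrices. -/
def IsRegularExtreme (φ : Matrix n n ℂ →ₗ[ℂ] Matrix n n ℂ) : Prop :=
  (φ ∈ Set.extremePoints ℝ (positiveMaps n) ∨
    φ ∈ Set.extremePoints ℝ (completelyPositiveMaps n)) ∧
  φ ∘ₗ (diagonalAlgebra n).val.toLinearMap ∈ Set.extremePoints ℝ (diagonalMaps n)

/-- The Choi matrix `∑ᵢⱼ Eᵢⱼ ⊗ φ(Eᵢⱼ)`. -/
def choi (φ : Matrix n n ℂ →ₗ[ℂ] Matrix n n ℂ) : Matrix (n × n) (n × n) ℂ :=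
  ∑ i, ∑ j, Matrix.single i j (1 : ℂ) ⊗ₖ φ (Matrix.single i j 1)

/-- The trace norm `Tr (b* b)^{1/2}`. -/
def traceNorm (b : Matrix n n ℂ) : ℝ :=
  (Matrix.trace (CFC.sqrt (bᴴ * b))).re

/-- The projective norm on `M_n ⊗ M_n`, with the operator norm on the first factor and the trace
norm on the second. -/
def projectiveNorm (x : Matrix (n × n) (n × n) ℂ) : ℝ :=
  sInf {r | ∃ (k : ℕ) (a b : Fin k → Matrix n n ℂ),
    x = ∑ i, a i ⊗ₖ b i ∧ r = ∑ i, ‖a i‖ * traceNorm (b i)}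

/-- The norm dual to the projective norm under the pairing `(ρ, a) ↦ Tr (ρ a)`. -/
def alphaNorm (ρ : Matrix (n × n) (n × n) ℂ) : ℝ :=
  sSup {r | ∃ a : Matrix (n × n) (n × n) ℂ, a ≠ 0 ∧ r = ‖(ρ * a).trace‖ / projectiveNorm a}

/-- Block positivity: `⟨x ⊗ y, ρ (x ⊗ y)⟩ ≥ 0` for all `x, y ∈ ℂⁿ`. -/
def IsBlockPositive (ρ : Matrix (n × n) (n × n) ℂ) : Prop :=
  ∀ x y : n → ℂ,
    0 ≤ (star fun p : n × n => x p.1 * y p.2) ⬝ᵥ (ρ *ᵥ fun p : n × n => x p.1 * y p.2)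

variable (n) in
/-- The set `𝔇` of Choi matrices of normalized unital positive maps: selfadjoint block positive
matrices of `α`-norm `1` and trace `n`. -/
def setD : Set (Matrix (n × n) (n × n) ℂ) :=
  {ρ | ρ.IsHermitian ∧ alphaNorm ρ = 1 ∧ IsBlockPositive ρ ∧ ρ.trace = (Fintype.card n : ℂ)}

/-- A symmetry is a selfadjoint unitary. -/
def IsSymmetry (s : Matrix (n × n) (n × n) ℂ) : Prop :=
  s.IsHermitian ∧ s * s = 1

/-- A vector of `ℂⁿ ⊗ ℂⁿ` is maximally entangled if it is `n^{-1/2} ∑ᵢ uᵢ ⊗ vᵢ` for some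
orthonormal bases `u`, `v` of `ℂⁿ`. -/
def IsMaximallyEntangled (x : n × n → ℂ) : Prop :=
  ∃ u v : OrthonormalBasis n ℂ (EuclideanSpace ℂ n),
    ∀ p : n × n, x p = ((√(Fintype.card n : ℝ) : ℝ) : ℂ)⁻¹ * ∑ i, u i p.1 * v i p.2

/-- The operator `|x⟩⟨x|`, which is the orthogonal projector `P_x` when `x` is a unit vector. -/
def ketBra {ι : Type} (x : ι → ℂ) : Matrix ι ι ℂ :=
  Matrix.vecMulVec x (star x)

/-- A rank one orthogonal projector. -/
def IsRankOneProjector (p : Matrix n n ℂ) : Prop :=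
  p.IsHermitian ∧ p * p = p ∧ p.rank = 1

variable (n) in
/-- The set consisting of the symmetries in `𝔇`, the matrices `n P_x` with `x` maximally entangled,
and the matrices `p ⊗ 1` with `p` a rank one projector. -/
def setDTilde : Set (Matrix (n × n) (n × n) ℂ) :=
  {s | s ∈ setD n ∧ IsSymmetry s} ∪
    {ρ | ∃ x : n × n → ℂ, IsMaximallyEntangled x ∧ ρ = (Fintype.card n : ℂ) • ketBra x} ∪
    {ρ | ∃ p : Matrix n n ℂ, IsRankOneProjector p ∧ ρ = p ⊗ₖ (1 : Matrix n n ℂ)}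

/-- The block diagonal matrix `∑ᵢ Eᵢᵢ ⊗ |yᵢ⟩⟨yᵢ|`, for an orthonormal basis `y`. -/
def diagonalChoi (y : OrthonormalBasis n ℂ (EuclideanSpace ℂ n)) : Matrix (n × n) (n × n) ℂ :=
  ∑ i, Matrix.single i i (1 : ℂ) ⊗ₖ ketBra (y i)

end RegularExtreme

end

/-! A positive unital contraction `φ` is tested by its Choi matrix through
`Tr (ρ_φ (a ⊗ b)) = Tr (φ(aᵀ) b)`; duality of the operator and trace norms then gives
`α(ρ_φ) = ‖φ‖`, and each of the listed matrices lies in `𝔇` because it is the Choi matrix of such a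
map.

Conversely, a unital map on the diagonal matrices is determined by `A = φ(E₀₀)`, and extremality
there makes `A` an extreme point of `{0 ≤ A ≤ 1}`, i.e. a projector. If `A` is `0` or `1`, then
positivity forces `ρ_φ = p ⊗ 1`. If `A` has rank one, then `φ` maps the units `Eᵢᵢ` to `v Eᵢᵢ v*`
for some unitary `v`, so that up to a unitary conjugation it fixes them and maps `E₀₁` to
`b E₀₁ + c E₁₀`. Positivity amounts to `|b| + |c| ≤ 1`; the extreme points of this ball have
`b = 0` or `c = 0` and the other coefficient of modulus one, so `φ` is a convex combination of maps
`a ↦ u a u*` and `a ↦ u aᵀ u*`, whose Choi matrices are `2 P_x` and symmetries. Complete positivity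
forces `c = 0` and leaves only the first kind. -/

open scoped Matrix Kronecker ComplexOrder MatrixOrder Matrix.Norms.L2Operator

namespace RegularExtreme

/-! ### Matrices as operators -/

section Operator

variable {n : Type*} [Fintype n] [DecidableEq n]

theorem l2_opNorm_transpose (a : Matrix n n ℂ) : ‖aᵀ‖ = ‖a‖ :=
  StarAlgEquiv.norm_map
    (StarAlgEquiv.ofAlgEquiv (Matrix.transposeAlgEquiv n ℂ ℂ) fun _ => rfl) a

theorem norm_inner_toEuclideanCLM_le (a : Matrix n n ℂ) (x y : EuclideanSpace ℂ n) :
    ‖inner ℂ x (Matrix.toEuclideanCLM (𝕜 := ℂ) a y)‖ ≤ ‖a‖ * ‖x‖ * ‖y‖ :=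
  calc ‖inner ℂ x (Matrix.toEuclideanCLM (𝕜 := ℂ) a y)‖
      ≤ ‖x‖ * ‖Matrix.toEuclideanCLM (𝕜 := ℂ) a y‖ := norm_inner_le_norm _ _
    _ ≤ ‖x‖ * (‖a‖ * ‖y‖) := by
      gcongr
      exact (Matrix.toEuclideanCLM (𝕜 := ℂ) a).le_opNorm y
    _ = ‖a‖ * ‖x‖ * ‖y‖ := by ring

theorem norm_apply_le_l2_opNorm (a : Matrix n n ℂ) (i j : n) : ‖a i j‖ ≤ ‖a‖ := by
  have h := norm_inner_toEuclideanCLM_le a (EuclideanSpace.single i 1) (EuclideanSpace.single j 1)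
  rw [EuclideanSpace.inner_single_left, Matrix.ofLp_toEuclideanCLM] at h
  simpa using h

theorem trace_eq_sum_inner_toEuclideanCLM (a : Matrix n n ℂ)
    (f : OrthonormalBasis n ℂ (EuclideanSpace ℂ n)) :
    a.trace = ∑ i, inner ℂ (f i) (Matrix.toEuclideanCLM (𝕜 := ℂ) a (f i)) := by
  have h := LinearMap.trace_eq_sum_inner (Matrix.toEuclideanLin a) f
  rwa [Matrix.toEuclideanLin_eq_toLin_orthonormal, Matrix.trace_toLin_eq,
    ← Matrix.toEuclideanLin_eq_toLin_orthonormal] at h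

theorem norm_toEuclideanCLM_eq_of_conjTranspose_mul_self_eq {b c : Matrix n n ℂ}
    (h : bᴴ * b = cᴴ * c) (x : EuclideanSpace ℂ n) :
    ‖Matrix.toEuclideanCLM (𝕜 := ℂ) b x‖ = ‖Matrix.toEuclideanCLM (𝕜 := ℂ) c x‖ := by
  have hsqrt (d : Matrix n n ℂ) : ‖Matrix.toEuclideanCLM (𝕜 := ℂ) d x‖ =
      √(RCLike.re (inner ℂ x (Matrix.toEuclideanCLM (𝕜 := ℂ) (dᴴ * d) x))) := by
    rw [ContinuousLinearMap.apply_norm_eq_sqrt_inner_adjoint_right, map_mul,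
      ← Matrix.star_eq_conjTranspose, map_star]
    rfl
  rw [hsqrt, hsqrt, h]

end Operator

section Vanishing

variable {n : Type*}

theorem eq_zero_of_forall_star_dotProduct_mulVec_eq_zero [Fintype n] {a : Matrix n n ℂ}
    (h : ∀ y : n → ℂ, star y ⬝ᵥ (a *ᵥ y) = 0) : a = 0 := by
  classical
  have hlin : Matrix.toEuclideanLin a = 0 := by
    rw [← inner_map_self_eq_zero]
    intro x
    rw [← inner_conj_symm, EuclideanSpace.inner_eq_star_dotProduct, dotProduct_comm]
    simpa using h x.ofLp
  exact (map_eq_zero_iff _ (LinearEquiv.injective _)).mp hlin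

theorem apply_eq_zero_of_posSemidef_of_diag_eq_zero [Finite n] {a : Matrix n n ℂ}
    (ha : a.PosSemidef) {j : n} (hj : a j j = 0) (i : n) : a i j = 0 := by
  classical
  have := Fintype.ofFinite n
  have hcol := (ha.dotProduct_mulVec_zero_iff (Pi.single j 1)).mp (by simpa using hj)
  simpa using congrFun hcol i

theorem posSemidef_single [Finite n] [DecidableEq n] (i : n) :
    (Matrix.single i i (1 : ℂ)).PosSemidef := by
  have := Fintype.ofFinite n
  simpa [← Matrix.single_eq_single_vecMulVec_single] using
    Matrix.posSemidef_vecMulVec_self_star (Pi.single i (1 : ℂ))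

end Vanishing

/-! ### The trace norm and the projective norm -/

section Norms

theorem exists_eq_sum_kronecker {n : Type*} [Finite n] (z : Matrix (n × n) (n × n) ℂ) :
    ∃ (k : ℕ) (a b : Fin k → Matrix n n ℂ), z = ∑ i, a i ⊗ₖ b i := by
  classical
  have := Fintype.ofFinite n
  let e := (Fintype.equivFin (n × n)).symm
  refine ⟨_, fun r => Matrix.single (e r).1 (e r).2 1,
    fun r => Matrix.of fun j l => z ((e r).1, j) ((e r).2, l), ?_⟩
  rw [Equiv.sum_comp e fun p : n × n =>
    Matrix.single p.1 p.2 (1 : ℂ) ⊗ₖ Matrix.of fun j l => z (p.1, j) (p.2, l)]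
  ext ⟨i, j⟩ ⟨k, l⟩
  simp [Fintype.sum_prod_type, Matrix.sum_apply, Matrix.single_apply, Matrix.kroneckerMap_apply,
    ite_and]

variable {n : Type} [Fintype n] [DecidableEq n]

theorem traceNorm_nonneg (b : Matrix n n ℂ) : 0 ≤ traceNorm b :=
  (Complex.nonneg_iff.mp (Matrix.nonneg_iff_posSemidef.mp (CFC.sqrt_nonneg _)).trace_nonneg).1

theorem traceNorm_of_posSemidef {b : Matrix n n ℂ} (hb : b.PosSemidef) :
    traceNorm b = b.trace.re := by
  rw [traceNorm, hb.1.eq, CFC.sqrt_mul_self b hb.nonneg]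

theorem norm_trace_mul_le (a b : Matrix n n ℂ) : ‖(a * b).trace‖ ≤ ‖a‖ * traceNorm b := by
  have habs : (CFC.sqrt (bᴴ * b)).PosSemidef :=
    Matrix.nonneg_iff_posSemidef.mp (CFC.sqrt_nonneg _)
  have hsq : bᴴ * b = (CFC.sqrt (bᴴ * b))ᴴ * CFC.sqrt (bᴴ * b) := by
    rw [habs.1.eq, CFC.sqrt_mul_sqrt_self _ (Matrix.posSemidef_conjTranspose_mul_self b).nonneg]
  let f := habs.1.eigenvectorBasis
  have hnorm (i) : ‖Matrix.toEuclideanCLM (𝕜 := ℂ) b (f i)‖ = habs.1.eigenvalues i := by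
    have heigen : Matrix.toEuclideanCLM (𝕜 := ℂ) (CFC.sqrt (bᴴ * b)) (f i) =
        habs.1.eigenvalues i • f i :=
      WithLp.ofLp_injective 2 (habs.1.mulVec_eigenvectorBasis i)
    rw [norm_toEuclideanCLM_eq_of_conjTranspose_mul_self_eq hsq, heigen, norm_smul,
      f.norm_eq_one, mul_one, Real.norm_of_nonneg (habs.eigenvalues_nonneg i)]
  have hterm (i) : ‖inner ℂ (f i) (Matrix.toEuclideanCLM (𝕜 := ℂ) (a * b) (f i))‖ ≤
      ‖a‖ * habs.1.eigenvalues i := by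
    have h := norm_inner_toEuclideanCLM_le a (f i) (Matrix.toEuclideanCLM (𝕜 := ℂ) b (f i))
    rwa [f.norm_eq_one, mul_one, hnorm, ← mul_apply_eq_comp, ← map_mul] at h
  calc ‖(a * b).trace‖
      ≤ ∑ i, ‖inner ℂ (f i) (Matrix.toEuclideanCLM (𝕜 := ℂ) (a * b) (f i))‖ := by
        rw [trace_eq_sum_inner_toEuclideanCLM _ f]
        exact norm_sum_le _ _
    _ ≤ ∑ i, ‖a‖ * habs.1.eigenvalues i := Finset.sum_le_sum fun i _ => hterm i
    _ = ‖a‖ * traceNorm b := by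
        rw [traceNorm, habs.1.trace_eq_sum_eigenvalues, ← Finset.mul_sum]
        simp

theorem projectiveNorm_kronecker_le (a b : Matrix n n ℂ) :
    projectiveNorm (a ⊗ₖ b) ≤ ‖a‖ * traceNorm b := by
  refine csInf_le ⟨0, ?_⟩ ⟨1, fun _ => a, fun _ => b, by simp, by simp⟩
  rintro _ ⟨k, a, b, -, rfl⟩
  exact Finset.sum_nonneg fun i _ => mul_nonneg (norm_nonneg _) (traceNorm_nonneg _)

end Norms

/-! ### Choi matrices -/

section Choi

variable {n m : Type} [Fintype n] [DecidableEq n]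

theorem map_eq_sum_single (φ : Matrix n n ℂ →ₗ[ℂ] Matrix m m ℂ) (a : Matrix n n ℂ) :
    φ a = ∑ i, ∑ j, a i j • φ (Matrix.single i j 1) := by
  conv_lhs => rw [Matrix.matrix_eq_sum_single a]
  simp only [map_sum, ← map_smul, Matrix.smul_single, smul_eq_mul, mul_one]

theorem choi_apply (φ : Matrix n n ℂ →ₗ[ℂ] Matrix n n ℂ) (i j k l : n) :
    choi φ (i, j) (k, l) = φ (Matrix.single i k 1) j l := by
  simp [choi, Matrix.sum_apply, Matrix.single_apply, Matrix.kroneckerMap_apply, ite_and]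

theorem trace_choi_mul_kronecker (φ : Matrix n n ℂ →ₗ[ℂ] Matrix n n ℂ) (a b : Matrix n n ℂ) :
    (choi φ * (a ⊗ₖ b)).trace = (φ aᵀ * b).trace := by
  rw [map_eq_sum_single φ aᵀ, choi]
  simp only [Finset.sum_mul, Matrix.trace_sum, ← Matrix.mul_kronecker_mul,
    Matrix.trace_kronecker, Matrix.smul_mul, Matrix.trace_smul, smul_eq_mul,
    Matrix.transpose_apply]
  refine Finset.sum_congr rfl fun i _ => Finset.sum_congr rfl fun j _ => ?_
  simp [Matrix.trace_single_mul]

theorem trace_choi {φ : Matrix n n ℂ →ₗ[ℂ] Matrix n n ℂ} (hone : φ 1 = 1) :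
    (choi φ).trace = Fintype.card n := by
  simpa [hone] using trace_choi_mul_kronecker φ 1 1

theorem star_dotProduct_choi_mulVec (φ : Matrix n n ℂ →ₗ[ℂ] Matrix n n ℂ) (x y : n → ℂ) :
    (star fun p : n × n => x p.1 * y p.2) ⬝ᵥ (choi φ *ᵥ fun p : n × n => x p.1 * y p.2) =
      star y ⬝ᵥ (φ (Matrix.vecMulVec (star x) x) *ᵥ y) := by
  have hkron : Matrix.vecMulVec x (star x) ⊗ₖ Matrix.vecMulVec y (star y) =
      Matrix.vecMulVec (fun p : n × n => x p.1 * y p.2)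
        (star fun p : n × n => x p.1 * y p.2) := by
    ext p q
    simp only [Matrix.kroneckerMap_apply, Matrix.vecMulVec_apply, Pi.star_apply, star_mul']
    ring
  have htrace := trace_choi_mul_kronecker φ (Matrix.vecMulVec x (star x))
    (Matrix.vecMulVec y (star y))
  rwa [hkron, Matrix.mul_vecMulVec, Matrix.mul_vecMulVec, Matrix.trace_vecMulVec,
    Matrix.trace_vecMulVec, dotProduct_comm, dotProduct_comm _ (star y),
    Matrix.transpose_vecMulVec] at htrace

variable [Fintype m] [DecidableEq m]

theorem IsNormalized.norm_apply_le {φ : Matrix n n ℂ →ₗ[ℂ] Matrix m m ℂ} (hφ : IsNormalized φ)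
    (a : Matrix n n ℂ) : ‖φ a‖ ≤ ‖a‖ := by
  simpa [show ‖LinearMap.toContinuousLinearMap φ‖ = 1 from hφ] using
    (LinearMap.toContinuousLinearMap φ).le_opNorm a

theorem isNormalized_of_norm_apply_le [Nonempty n] [Nonempty m]
    {φ : Matrix n n ℂ →ₗ[ℂ] Matrix m m ℂ} (hone : φ 1 = 1) (hle : ∀ a, ‖φ a‖ ≤ ‖a‖) :
    IsNormalized φ := by
  apply le_antisymm
  · exact ContinuousLinearMap.opNorm_le_bound _ zero_le_one fun a => by simpa using hle a
  · simpa [hone] using (LinearMap.toContinuousLinearMap φ).le_opNorm 1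

theorem norm_trace_choi_mul_le {φ : Matrix n n ℂ →ₗ[ℂ] Matrix n n ℂ} (hφ : IsNormalized φ)
    (z : Matrix (n × n) (n × n) ℂ) : ‖(choi φ * z).trace‖ ≤ projectiveNorm z := by
  obtain ⟨k, a, b, hz⟩ := exists_eq_sum_kronecker z
  refine le_csInf ⟨_, k, a, b, hz, rfl⟩ ?_
  rintro _ ⟨k, a, b, rfl, rfl⟩
  rw [Finset.mul_sum, Matrix.trace_sum]
  refine (norm_sum_le _ _).trans (Finset.sum_le_sum fun i _ => ?_)
  calc ‖(choi φ * (a i ⊗ₖ b i)).trace‖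
      ≤ ‖φ (a i)ᵀ‖ * traceNorm (b i) := by
        rw [trace_choi_mul_kronecker]
        exact norm_trace_mul_le _ _
    _ ≤ ‖a i‖ * traceNorm (b i) := by
        rw [← l2_opNorm_transpose (a i)]
        exact mul_le_mul_of_nonneg_right (hφ.norm_apply_le _) (traceNorm_nonneg _)

theorem alphaNorm_choi [Nonempty n] {φ : Matrix n n ℂ →ₗ[ℂ] Matrix n n ℂ} (hone : φ 1 = 1)
    (hφ : IsNormalized φ) : alphaNorm (choi φ) = 1 := by
  have hle (z : Matrix (n × n) (n × n) ℂ) : ‖(choi φ * z).trace‖ / projectiveNorm z ≤ 1 :=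
    div_le_one_of_le₀ (norm_trace_choi_mul_le hφ z)
      ((norm_nonneg _).trans (norm_trace_choi_mul_le hφ z))
  have htrace : ‖(choi φ * (1 : Matrix (n × n) (n × n) ℂ)).trace‖ = Fintype.card n := by
    rw [mul_one, trace_choi hone, Complex.norm_natCast]
  have hproj : projectiveNorm (1 : Matrix (n × n) (n × n) ℂ) = Fintype.card n := by
    refine le_antisymm ?_ (htrace ▸ norm_trace_choi_mul_le hφ 1)
    simpa [traceNorm_of_posSemidef Matrix.PosSemidef.one] using
      projectiveNorm_kronecker_le (1 : Matrix n n ℂ) 1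
  apply le_antisymm
  · refine csSup_le ⟨_, 1, one_ne_zero, rfl⟩ ?_
    rintro _ ⟨z, -, rfl⟩
    exact hle z
  · refine le_csSup ⟨1, ?_⟩ ⟨1, one_ne_zero, ?_⟩
    · rintro _ ⟨z, -, rfl⟩
      exact hle z
    · rw [htrace, hproj, div_self (Nat.cast_ne_zero.mpr Fintype.card_ne_zero)]

end Choi

/-! ### Positive and completely positive maps -/

section Positive

variable {n m : Type}

theorem IsCompletelyPositive.isPositiveMap {φ : Matrix n n ℂ →ₗ[ℂ] Matrix m m ℂ}
    (hφ : IsCompletelyPositive φ) : IsPositiveMap φ := fun a ha =>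
  (hφ 1 (Matrix.of fun _ _ => a) (ha.submatrix Prod.snd)).submatrix fun i => (0, i)

theorem IsPositiveMap.map_conjTranspose [Finite n] [Finite m]
    {φ : Matrix n n ℂ →ₗ[ℂ] Matrix m m ℂ} (hφ : IsPositiveMap φ) (a : Matrix n n ℂ) :
    φ aᴴ = (φ a)ᴴ := by
  classical
  have := Fintype.ofFinite n
  have := Fintype.ofFinite m
  exact map_star (PositiveLinearMap.mk₀ φ fun b hb =>
    (hφ b (Matrix.nonneg_iff_posSemidef.mp hb)).nonneg) a

variable [Finite n] [DecidableEq n]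

theorem IsPositiveMap.map_single_swap [Finite m]
    {φ : Matrix n n ℂ →ₗ[ℂ] Matrix m m ℂ} (hφ : IsPositiveMap φ) (i j : n) :
    φ (Matrix.single j i 1) = (φ (Matrix.single i j 1))ᴴ := by
  rw [← hφ.map_conjTranspose, Matrix.conjTranspose_single, star_one]

theorem IsPositiveMap.posSemidef_star_dotProduct_map_single_mulVec [Fintype m]
    {φ : Matrix n n ℂ →ₗ[ℂ] Matrix m m ℂ} (hφ : IsPositiveMap φ) (y : m → ℂ) :
    (Matrix.of fun i j => star y ⬝ᵥ (φ (Matrix.single i j 1) *ᵥ y)).PosSemidef := by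
  have := Fintype.ofFinite n
  refine Matrix.PosSemidef.of_dotProduct_mulVec_nonneg ?_ fun x => ?_
  · ext i j
    rw [Matrix.conjTranspose_apply, Matrix.of_apply, Matrix.of_apply, hφ.map_single_swap,
      Matrix.star_dotProduct, Matrix.star_mulVec, Matrix.conjTranspose_conjTranspose,
      ← Matrix.dotProduct_mulVec, star_star]
  · have hexpand (q : Matrix n n ℂ) :
        star x ⬝ᵥ (q *ᵥ x) = ∑ i, ∑ j, (star x i * x j) * q i j := by
      simp only [dotProduct, Matrix.mulVec, Finset.mul_sum]
      exact Finset.sum_congr rfl fun i _ => Finset.sum_congr rfl fun j _ => by ring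
    have hform : star x ⬝ᵥ ((Matrix.of fun i j => star y ⬝ᵥ (φ (Matrix.single i j 1) *ᵥ y)) *ᵥ x) =
        star y ⬝ᵥ (φ (Matrix.vecMulVec (star x) x) *ᵥ y) := by
      simp only [hexpand, map_eq_sum_single φ (Matrix.vecMulVec _ _), Matrix.sum_mulVec,
        dotProduct_sum, Matrix.smul_mulVec, dotProduct_smul, Matrix.vecMulVec_apply, smul_eq_mul,
        Matrix.of_apply]
    rw [hform]
    exact (hφ _ (Matrix.posSemidef_vecMulVec_star_self x)).dotProduct_mulVec_nonneg y

theorem IsPositiveMap.star_dotProduct_map_single_mulVec_eq_zero [Fintype m]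
    {φ : Matrix n n ℂ →ₗ[ℂ] Matrix m m ℂ} (hφ : IsPositiveMap φ) {j : n} {y : m → ℂ}
    (hy : star y ⬝ᵥ (φ (Matrix.single j j 1) *ᵥ y) = 0) (i : n) :
    star y ⬝ᵥ (φ (Matrix.single i j 1) *ᵥ y) = 0 :=
  apply_eq_zero_of_posSemidef_of_diag_eq_zero
    (hφ.posSemidef_star_dotProduct_map_single_mulVec y) hy i

theorem IsPositiveMap.map_single_apply_self_eq_zero [Finite m]
    {φ : Matrix n n ℂ →ₗ[ℂ] Matrix m m ℂ} (hφ : IsPositiveMap φ) {j : n} {k : m}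
    (hk : φ (Matrix.single j j 1) k k = 0) (i : n) :
    φ (Matrix.single i j 1) k k = 0 := by
  classical
  have := Fintype.ofFinite m
  simpa using hφ.star_dotProduct_map_single_mulVec_eq_zero (y := Pi.single k 1) (by simpa) i

theorem IsPositiveMap.map_single_eq_zero [Finite m]
    {φ : Matrix n n ℂ →ₗ[ℂ] Matrix m m ℂ} (hφ : IsPositiveMap φ) {j : n}
    (hj : φ (Matrix.single j j 1) = 0) (i : n) :
    φ (Matrix.single i j 1) = 0 := by
  have := Fintype.ofFinite m
  exact eq_zero_of_forall_star_dotProduct_mulVec_eq_zero fun y =>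
    hφ.star_dotProduct_map_single_mulVec_eq_zero (by simp [hj]) i

end Positive

section PositiveChoi

variable {n : Type} [Fintype n] [DecidableEq n]

theorem choi_mem_setD [Nonempty n] {φ : Matrix n n ℂ →ₗ[ℂ] Matrix n n ℂ}
    (hφ : φ ∈ positiveMaps n) : choi φ ∈ setD n := by
  obtain ⟨hpos, hone, hnorm⟩ := hφ
  refine ⟨?_, alphaNorm_choi hone hnorm, fun x y => ?_, trace_choi hone⟩
  · ext ⟨i, j⟩ ⟨k, l⟩
    simp [choi_apply, hpos.map_single_swap i k]
  · rw [star_dotProduct_choi_mulVec]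
    exact (hpos _ (Matrix.posSemidef_vecMulVec_star_self x)).dotProduct_mulVec_nonneg y

theorem IsPositiveMap.choi_eq_single_kronecker {φ : Matrix n n ℂ →ₗ[ℂ] Matrix n n ℂ}
    (hφ : IsPositiveMap φ) {i : n} (hi : ∀ j ≠ i, φ (Matrix.single j j 1) = 0) :
    choi φ = Matrix.single i i 1 ⊗ₖ φ (Matrix.single i i 1) := by
  have hright (k : n) {j : n} (hj : j ≠ i) : φ (Matrix.single k j 1) = 0 :=
    hφ.map_single_eq_zero (hi j hj) k
  have hleft {j : n} (hj : j ≠ i) (k : n) : φ (Matrix.single j k 1) = 0 := by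
    rw [hφ.map_single_swap, hright k hj, Matrix.conjTranspose_zero]
  rw [choi, Finset.sum_eq_single i, Finset.sum_eq_single i] <;> simp +contextual [hright, hleft]

theorem completelyPositiveMaps_subset_positiveMaps :
    completelyPositiveMaps n ⊆ positiveMaps n :=
  fun _ hφ => ⟨hφ.1.isPositiveMap, hφ.2⟩

theorem IsCompletelyPositive.posSemidef_choi {φ : Matrix n n ℂ →ₗ[ℂ] Matrix n n ℂ}
    (hφ : IsCompletelyPositive φ) : (choi φ).PosSemidef := by
  let e := Fintype.equivFin n
  have hunits : (Matrix.comp _ _ n n ℂ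
      (Matrix.of fun i j => Matrix.single (e.symm i) (e.symm j) 1)).PosSemidef := by
    convert Matrix.posSemidef_vecMulVec_self_star
      fun p : Fin (Fintype.card n) × n => if e.symm p.1 = p.2 then (1 : ℂ) else 0 using 1
    ext ⟨i, p⟩ ⟨j, q⟩
    simp only [Matrix.vecMulVec_apply, Pi.star_apply, Matrix.comp_apply, Matrix.of_apply,
      Matrix.single_apply, ite_and]
    split_ifs <;> simp
  convert (hφ _ _ hunits).submatrix fun p : n × n => (e p.1, p.2)
  ext ⟨i, j⟩ ⟨k, l⟩
  simp [choi_apply]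

end PositiveChoi

theorem IsCompletelyPositive.map_single_apply_eq_zero {n : Type} [Finite n] [DecidableEq n]
    {φ : Matrix n n ℂ →ₗ[ℂ] Matrix n n ℂ} (hφ : IsCompletelyPositive φ) {j l : n}
    (h : φ (Matrix.single j j 1) l l = 0) (i k : n) : φ (Matrix.single i j 1) k l = 0 := by
  have := Fintype.ofFinite n
  rw [← choi_apply] at h ⊢
  exact apply_eq_zero_of_posSemidef_of_diag_eq_zero hφ.posSemidef_choi h (i, k)

/-! ### Convexity and extreme points -/

section Convexity

theorem mem_of_mem_extremePoints_of_mem_convexHull {E : Type*} [AddCommGroup E] [Module ℝ E]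
    {S A : Set E} (hS : Convex ℝ S) (hA : A ⊆ S) {x : E} (hx : x ∈ S.extremePoints ℝ)
    (hxA : x ∈ convexHull ℝ A) : x ∈ A :=
  extremePoints_convexHull_subset
    (inter_extremePoints_subset_extremePoints_of_subset (convexHull_min hA hS) ⟨hxA, hx⟩)

variable {n : Type} [Fintype n] [DecidableEq n] [Nonempty n]

theorem isNormalized_convexCombination {φ ψ : Matrix n n ℂ →ₗ[ℂ] Matrix n n ℂ}
    (hφ : φ 1 = 1 ∧ IsNormalized φ) (hψ : ψ 1 = 1 ∧ IsNormalized ψ) {s t : ℝ} (hs : 0 ≤ s)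
    (ht : 0 ≤ t) (hst : s + t = 1) :
    (s • φ + t • ψ) 1 = 1 ∧ IsNormalized (s • φ + t • ψ) := by
  have hone : (s • φ + t • ψ) 1 = 1 := by
    simp only [LinearMap.add_apply, LinearMap.smul_apply, hφ.1, hψ.1, ← add_smul, hst, one_smul]
  refine ⟨hone, isNormalized_of_norm_apply_le hone fun a => ?_⟩
  calc ‖(s • φ + t • ψ) a‖ ≤ ‖s • φ a‖ + ‖t • ψ a‖ := norm_add_le _ _
    _ ≤ s * ‖a‖ + t * ‖a‖ := by
      rw [norm_smul, norm_smul, Real.norm_of_nonneg hs, Real.norm_of_nonneg ht]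
      gcongr
      exacts [hφ.2.norm_apply_le a, hψ.2.norm_apply_le a]
    _ = ‖a‖ := by rw [← add_mul, hst, one_mul]

theorem convex_positiveMaps : Convex ℝ (positiveMaps n) :=
  fun _ hφ _ hψ _ _ hs ht hst =>
    ⟨fun a ha => ((hφ.1 a ha).smul hs).add ((hψ.1 a ha).smul ht),
      isNormalized_convexCombination hφ.2 hψ.2 hs ht hst⟩

theorem convex_completelyPositiveMaps : Convex ℝ (completelyPositiveMaps n) :=
  fun _ hφ _ hψ _ _ hs ht hst =>
    ⟨fun k A hA => ((hφ.1 k A hA).smul hs).add ((hψ.1 k A hA).smul ht),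
      isNormalized_convexCombination hφ.2 hψ.2 hs ht hst⟩

end Convexity

/-! ### Conjugations, transposition and compression to the diagonal -/

section UnitaryConjugation

variable {n : Type} [DecidableEq n]

/-- The conditional expectation of `M_n` onto the diagonal matrices, which replaces all
off-diagonal entries by zero. -/
noncomputable def diagonalPart : Matrix n n ℂ →ₗ[ℂ] Matrix n n ℂ :=
  Matrix.diagonalLinearMap n ℂ ℂ ∘ₗ Matrix.diagLinearMap n ℂ ℂ

theorem diagonalPart_apply (a : Matrix n n ℂ) : diagonalPart a = Matrix.diagonal a.diag := rfl

variable [Fintype n]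

/-- The conjugation `a ↦ v a v*`, an automorphism of `M_n` when `v` is unitary. -/
noncomputable def conjMap (v : Matrix n n ℂ) : Matrix n n ℂ →ₗ[ℂ] Matrix n n ℂ :=
  LinearMap.mulLeftRight ℂ (v, vᴴ)

/-- The map `a ↦ v aᵀ v*`, an anti-automorphism of `M_n` when `v` is unitary. -/
noncomputable def transposeConjMap (v : Matrix n n ℂ) : Matrix n n ℂ →ₗ[ℂ] Matrix n n ℂ :=
  conjMap v ∘ₗ (Matrix.transposeLinearEquiv n n ℂ ℂ).toLinearMap

theorem conjMap_apply (v a : Matrix n n ℂ) : conjMap v a = v * a * vᴴ := rfl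

theorem transposeConjMap_apply (v a : Matrix n n ℂ) : transposeConjMap v a = v * aᵀ * vᴴ := rfl

theorem isCompletelyPositive_conjMap (v : Matrix n n ℂ) : IsCompletelyPositive (conjMap v) := by
  intro k A hA
  convert hA.mul_mul_conjTranspose_same ((1 : Matrix (Fin k) (Fin k) ℂ) ⊗ₖ v) using 1
  ext ⟨i, p⟩ ⟨j, q⟩
  simp [conjMap_apply, Matrix.mul_apply, Fintype.sum_prod_type, Matrix.one_apply,
    Matrix.kroneckerMap_apply, apply_ite (starRingEnd ℂ)]

theorem choi_conjMap (v : Matrix n n ℂ) : choi (conjMap v) = ketBra v.vec := by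
  ext ⟨i, j⟩ ⟨k, l⟩
  simp [choi_apply, conjMap_apply, ketBra, Matrix.vecMulVec_apply, Matrix.mul_apply,
    Matrix.single_apply, ite_and, Matrix.vec]

theorem choi_transposeConjMap_mul_self {v : Matrix n n ℂ} (hv : v ∈ Matrix.unitaryGroup n ℂ) :
    choi (transposeConjMap v) * choi (transposeConjMap v) = 1 := by
  have happly (i j k l : n) : choi (transposeConjMap v) (i, j) (k, l) = v j k * star (v l i) := by
    simp [choi_apply, transposeConjMap_apply, Matrix.mul_apply, Matrix.single_apply, ite_and]
  ext ⟨i, j⟩ ⟨k, l⟩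
  calc (choi (transposeConjMap v) * choi (transposeConjMap v)) (i, j) (k, l)
      = ∑ x, ∑ y, v j x * star (v y i) * (v y k * star (v l x)) := by
        simp only [Matrix.mul_apply, Fintype.sum_prod_type, happly]
    _ = (∑ x, v j x * star (v l x)) * ∑ y, star (v y i) * v y k := by
        rw [Finset.sum_mul_sum]
        exact Finset.sum_congr rfl fun x _ => Finset.sum_congr rfl fun y _ => by ring
    _ = (v * vᴴ) j l * (vᴴ * v) i k := by
        simp only [Matrix.mul_apply, Matrix.conjTranspose_apply]
    _ = (1 : Matrix (n × n) (n × n) ℂ) (i, j) (k, l) := by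
        rw [← Matrix.star_eq_conjTranspose, Matrix.mem_unitaryGroup_iff.mp hv,
          Matrix.mem_unitaryGroup_iff'.mp hv, mul_comm, ← Matrix.kronecker_apply,
          Matrix.one_kronecker_one]

variable [Nonempty n]

theorem comp_mem_positiveMaps {φ ψ : Matrix n n ℂ →ₗ[ℂ] Matrix n n ℂ}
    (hφ : φ ∈ positiveMaps n) (hψ : ψ ∈ positiveMaps n) : φ ∘ₗ ψ ∈ positiveMaps n := by
  have hone : (φ ∘ₗ ψ) 1 = 1 := by rw [LinearMap.comp_apply, hψ.2.1, hφ.2.1]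
  exact ⟨fun a ha => hφ.1 _ (hψ.1 a ha), hone, isNormalized_of_norm_apply_le hone fun a =>
    (hφ.2.2.norm_apply_le _).trans (hψ.2.2.norm_apply_le a)⟩

theorem conjMap_mem_completelyPositiveMaps {v : Matrix n n ℂ}
    (hv : v ∈ Matrix.unitaryGroup n ℂ) : conjMap v ∈ completelyPositiveMaps n := by
  have hone : conjMap v 1 = 1 := by
    rw [conjMap_apply, mul_one]
    exact Matrix.mem_unitaryGroup_iff.mp hv
  refine ⟨isCompletelyPositive_conjMap v, hone, isNormalized_of_norm_apply_le hone fun a => ?_⟩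
  rw [conjMap_apply, ← Matrix.star_eq_conjTranspose,
    CStarRing.norm_mul_mem_unitary _ (Unitary.star_mem hv), CStarRing.norm_mem_unitary_mul _ hv]

theorem conjMap_mem_positiveMaps {v : Matrix n n ℂ} (hv : v ∈ Matrix.unitaryGroup n ℂ) :
    conjMap v ∈ positiveMaps n :=
  completelyPositiveMaps_subset_positiveMaps (conjMap_mem_completelyPositiveMaps hv)

theorem transpose_mem_positiveMaps :
    (Matrix.transposeLinearEquiv n n ℂ ℂ).toLinearMap ∈ positiveMaps n :=
  ⟨fun _ ha => ha.transpose, Matrix.transpose_one,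
    isNormalized_of_norm_apply_le Matrix.transpose_one fun a => (l2_opNorm_transpose a).le⟩

theorem transposeConjMap_mem_positiveMaps {v : Matrix n n ℂ}
    (hv : v ∈ Matrix.unitaryGroup n ℂ) : transposeConjMap v ∈ positiveMaps n :=
  comp_mem_positiveMaps (conjMap_mem_positiveMaps hv) transpose_mem_positiveMaps

theorem diagonalPart_mem_positiveMaps : diagonalPart ∈ positiveMaps n := by
  have hone : diagonalPart (1 : Matrix n n ℂ) = 1 := by
    rw [diagonalPart_apply, Matrix.diag_one]
    exact Matrix.diagonal_one
  refine ⟨fun a ha => ?_, hone, isNormalized_of_norm_apply_le hone fun a => ?_⟩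
  · exact Matrix.posSemidef_diagonal_iff.mpr fun i => ha.diag_nonneg
  · rw [diagonalPart_apply, Matrix.l2_opNorm_diagonal]
    exact (pi_norm_le_iff_of_nonneg (norm_nonneg a)).mpr fun i => norm_apply_le_l2_opNorm a i i

end UnitaryConjugation

/-! ### Members of `𝔇` -/

section Members

variable {n : Type} [Fintype n]

theorem card_smul_ketBra_inv_sqrt_card_smul [Nonempty n] {ι : Type} (x : ι → ℂ) :
    (Fintype.card n : ℂ) • ketBra (((√(Fintype.card n : ℝ) : ℝ) : ℂ)⁻¹ • x) = ketBra x := by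
  have hsqrt : ((√(Fintype.card n : ℝ) : ℝ) : ℂ) * ((√(Fintype.card n : ℝ) : ℝ) : ℂ) =
      (Fintype.card n : ℂ) := by
    rw [← Complex.ofReal_mul, Real.mul_self_sqrt (Nat.cast_nonneg _), Complex.ofReal_natCast]
  have hcard : (Fintype.card n : ℂ) ≠ 0 := Nat.cast_ne_zero.mpr Fintype.card_ne_zero
  rw [ketBra, star_smul, Matrix.smul_vecMulVec, Matrix.vecMulVec_smul, smul_smul, smul_smul,
    star_inv₀, Complex.star_def, Complex.conj_ofReal, mul_assoc, ← mul_inv, hsqrt,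
    mul_inv_cancel₀ hcard, one_smul, ketBra]

theorem trace_mul_nonneg_of_posSemidef {a b : Matrix n n ℂ} (ha : a.PosSemidef)
    (hb : b.PosSemidef) : 0 ≤ (a * b).trace := by
  classical
  obtain ⟨c, rfl⟩ := CStarAlgebra.nonneg_iff_eq_star_mul_self.mp hb.nonneg
  rw [← mul_assoc, Matrix.trace_mul_comm, ← mul_assoc]
  exact (ha.mul_mul_conjTranspose_same c).trace_nonneg

variable [DecidableEq n]

theorem exists_mem_unitaryGroup_of_orthonormalBasis
    (f : OrthonormalBasis n ℂ (EuclideanSpace ℂ n)) :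
    ∃ v ∈ Matrix.unitaryGroup n ℂ, ∀ i j, v i j = f j i :=
  ⟨_, (EuclideanSpace.basisFun n ℂ).toMatrix_orthonormalBasis_mem_unitary f, fun _ _ => rfl⟩

theorem exists_orthonormalBasis_of_mem_unitaryGroup {v : Matrix n n ℂ}
    (hv : v ∈ Matrix.unitaryGroup n ℂ) :
    ∃ f : OrthonormalBasis n ℂ (EuclideanSpace ℂ n), ∀ i j, f j i = v i j := by
  let e := Unitary.linearIsometryEquiv
    ⟨Matrix.toEuclideanCLM (𝕜 := ℂ) v, Unitary.map_mem (Matrix.toEuclideanCLM (𝕜 := ℂ)) hv⟩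
  refine ⟨(EuclideanSpace.basisFun n ℂ).map e, fun i j => ?_⟩
  have h : e (EuclideanSpace.single j 1) =
      Matrix.toEuclideanCLM (𝕜 := ℂ) v (EuclideanSpace.single j 1) := rfl
  simp [h]

theorem isMaximallyEntangled_iff {x : n × n → ℂ} :
    IsMaximallyEntangled x ↔
      ∃ v ∈ Matrix.unitaryGroup n ℂ, x = ((√(Fintype.card n : ℝ) : ℝ) : ℂ)⁻¹ • v.vec := by
  constructor
  · rintro ⟨u, v, hx⟩
    obtain ⟨U, hU, hUu⟩ := exists_mem_unitaryGroup_of_orthonormalBasis u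
    obtain ⟨V, hV, hVv⟩ := exists_mem_unitaryGroup_of_orthonormalBasis v
    refine ⟨V * Uᵀ, mul_mem hV (Matrix.transpose_mem_unitaryGroup_iff.mpr hU), ?_⟩
    ext p
    simp [hx, Matrix.vec, Matrix.mul_apply, hUu, hVv, mul_comm]
  · rintro ⟨v, hv, rfl⟩
    obtain ⟨f, hf⟩ := exists_orthonormalBasis_of_mem_unitaryGroup hv
    exact ⟨EuclideanSpace.basisFun n ℂ, f, fun p => by simp [hf, Matrix.vec]⟩

theorem card_smul_ketBra_mem_setD [Nonempty n] {x : n × n → ℂ} (hx : IsMaximallyEntangled x) :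
    (Fintype.card n : ℂ) • ketBra x ∈ setD n := by
  obtain ⟨v, hv, rfl⟩ := isMaximallyEntangled_iff.mp hx
  rw [card_smul_ketBra_inv_sqrt_card_smul, ← choi_conjMap]
  exact choi_mem_setD (conjMap_mem_positiveMaps hv)

theorem choi_conjMap_mem_setDTilde [Nonempty n] {v : Matrix n n ℂ}
    (hv : v ∈ Matrix.unitaryGroup n ℂ) : choi (conjMap v) ∈ setDTilde n :=
  Or.inl (Or.inr ⟨_, isMaximallyEntangled_iff.mpr ⟨v, hv, rfl⟩, by
    rw [card_smul_ketBra_inv_sqrt_card_smul, choi_conjMap]⟩)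

theorem choi_transposeConjMap_mem_setDTilde [Nonempty n] {v : Matrix n n ℂ}
    (hv : v ∈ Matrix.unitaryGroup n ℂ) : choi (transposeConjMap v) ∈ setDTilde n :=
  have hmem := choi_mem_setD (transposeConjMap_mem_positiveMaps hv)
  Or.inl (Or.inl ⟨hmem, hmem.1, choi_transposeConjMap_mul_self hv⟩)

theorem kronecker_one_mem_setD [Nonempty n] {ρ : Matrix n n ℂ} (hρ : ρ.PosSemidef)
    (htrace : ρ.trace = 1) : ρ ⊗ₖ (1 : Matrix n n ℂ) ∈ setD n := by
  let φ : Matrix n n ℂ →ₗ[ℂ] Matrix n n ℂ :=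
    (Matrix.traceLinearMap n ℂ ℂ ∘ₗ LinearMap.mulRight ℂ ρᵀ).smulRight 1
  have hφ (a) : φ a = (a * ρᵀ).trace • 1 := rfl
  have hone : φ 1 = 1 := by rw [hφ, one_mul, Matrix.trace_transpose, htrace, one_smul]
  have hnorm (a) : ‖φ a‖ ≤ ‖a‖ := by
    have h := norm_trace_mul_le a ρᵀ
    rwa [traceNorm_of_posSemidef hρ.transpose, Matrix.trace_transpose, htrace, Complex.one_re,
      mul_one, ← mul_one ‖(a * ρᵀ).trace‖, ← norm_one (α := Matrix n n ℂ), ← norm_smul] at h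
  have hchoi : choi φ = ρ ⊗ₖ 1 := by
    ext ⟨i, j⟩ ⟨k, l⟩
    simp [choi_apply, hφ, Matrix.trace_single_mul, Matrix.kroneckerMap_apply]
  rw [← hchoi]
  have hpos : IsPositiveMap φ := fun a ha =>
    Matrix.PosSemidef.one.smul (trace_mul_nonneg_of_posSemidef ha hρ.transpose)
  exact choi_mem_setD ⟨hpos, hone, isNormalized_of_norm_apply_le hone hnorm⟩

theorem diagonalChoi_mem_setD [Nonempty n] (y : OrthonormalBasis n ℂ (EuclideanSpace ℂ n)) :
    diagonalChoi y ∈ setD n := by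
  obtain ⟨v, hv, hvy⟩ := exists_mem_unitaryGroup_of_orthonormalBasis y
  have hchoi : choi (conjMap v ∘ₗ diagonalPart) = diagonalChoi y := by
    ext ⟨i, j⟩ ⟨k, l⟩
    simp [choi_apply, conjMap_apply, diagonalPart_apply, diagonalChoi, ketBra, Matrix.sum_apply,
      Matrix.kroneckerMap_apply, Matrix.vecMulVec_apply, Matrix.mul_apply, Matrix.single_apply,
      Matrix.diagonal_apply, hvy, ite_and, eq_comm]
  rw [← hchoi]
  exact choi_mem_setD (comp_mem_positiveMaps (conjMap_mem_positiveMaps hv)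
    diagonalPart_mem_positiveMaps)

end Members

/-! ### Projectors -/

section Projector

variable {n : Type} [Fintype n]

theorem trace_eq_rank_of_isIdempotentElem {p : Matrix n n ℂ} (hp : IsIdempotentElem p) :
    p.trace = p.rank := by
  classical
  have hproj := (LinearMap.isProj_range_iff_isIdempotentElem _).mpr (hp.map Matrix.toLinAlgEquiv')
  rw [← Matrix.trace_toLin'_eq p]
  exact hproj.trace

variable [DecidableEq n]

theorem exists_eq_unitary_mul_diagonal_mul_of_isStarProjection {p : Matrix n n ℂ}
    (hp : IsStarProjection p) :
    ∃ v ∈ Matrix.unitaryGroup n ℂ, ∃ s : Finset n,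
      p = v * Matrix.diagonal (fun i => if i ∈ s then 1 else 0) * vᴴ := by
  have hherm : p.IsHermitian := hp.isSelfAdjoint
  have heigen (i) : hherm.eigenvalues i = 0 ∨ hherm.eigenvalues i = 1 :=
    hp.isIdempotentElem.spectrum_subset ℝ (hherm.eigenvalues_mem_spectrum_real i)
  refine ⟨_, hherm.eigenvectorUnitary.2, Finset.univ.filter (hherm.eigenvalues · = 1), ?_⟩
  conv_lhs => rw [hherm.spectral_theorem, Unitary.conjStarAlgAut_apply]
  congr! 3
  ext i
  rcases heigen i with h | h <;> simp [h]

theorem submatrix_id_mem_unitaryGroup {v : Matrix n n ℂ} (hv : v ∈ Matrix.unitaryGroup n ℂ)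
    (σ : Equiv.Perm n) : v.submatrix id σ ∈ Matrix.unitaryGroup n ℂ := by
  rw [Matrix.mem_unitaryGroup_iff, Matrix.star_eq_conjTranspose, Matrix.conjTranspose_submatrix,
    Matrix.submatrix_mul_equiv, ← Matrix.star_eq_conjTranspose, Matrix.mem_unitaryGroup_iff.mp hv,
    Matrix.submatrix_id_id]

theorem isStarProjection_fin_two {p : Matrix (Fin 2) (Fin 2) ℂ} (hp : IsStarProjection p) :
    p = 0 ∨ p = 1 ∨ ∃ v ∈ Matrix.unitaryGroup (Fin 2) ℂ, p = v * Matrix.single 0 0 1 * vᴴ := by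
  obtain ⟨v, hv, s, rfl⟩ := exists_eq_unitary_mul_diagonal_mul_of_isStarProjection hp
  have hs : ∀ s : Finset (Fin 2), s = ∅ ∨ s = Finset.univ ∨ ∃ i, s = {i} := by decide
  rcases hs s with rfl | rfl | ⟨i, rfl⟩
  · simp
  · right; left
    have hv' : v * vᴴ = 1 := Matrix.mem_unitaryGroup_iff.mp hv
    simp [hv']
  · refine Or.inr (Or.inr ⟨_, submatrix_id_mem_unitaryGroup hv (Equiv.swap 0 i), ?_⟩)
    have hsingle : Matrix.single 0 0 (1 : ℂ) =
        (Matrix.diagonal fun j => if j ∈ ({i} : Finset (Fin 2)) then (1 : ℂ) else 0).submatrix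
          (Equiv.swap 0 i) (Equiv.swap 0 i) := by
      ext j k
      fin_cases i <;> fin_cases j <;> fin_cases k <;> simp
    rw [hsingle, Matrix.conjTranspose_submatrix, Matrix.submatrix_mul_equiv,
      Matrix.submatrix_mul_equiv, Matrix.submatrix_id_id]

theorem isRankOneProjector_single (i : n) : IsRankOneProjector (Matrix.single i i (1 : ℂ)) := by
  have hidem : Matrix.single i i (1 : ℂ) * Matrix.single i i 1 = Matrix.single i i 1 := by simp
  refine ⟨by simp [Matrix.IsHermitian], hidem, ?_⟩
  have htrace := trace_eq_rank_of_isIdempotentElem hidem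
  rw [Matrix.trace_single_eq_same] at htrace
  exact_mod_cast htrace.symm

theorem IsRankOneProjector.kronecker_one_mem_setD [Nonempty n] {p : Matrix n n ℂ}
    (hp : IsRankOneProjector p) : p ⊗ₖ (1 : Matrix n n ℂ) ∈ setD n := by
  obtain ⟨hherm, hidem, hrank⟩ := hp
  refine RegularExtreme.kronecker_one_mem_setD ?_ ?_
  · have h := Matrix.posSemidef_conjTranspose_mul_self p
    rwa [hherm.eq, hidem] at h
  · rw [trace_eq_rank_of_isIdempotentElem hidem, hrank, Nat.cast_one]

theorem setDTilde_union_range_diagonalChoi_subset_setD [Nonempty n] :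
    setDTilde n ∪ Set.range (diagonalChoi (n := n)) ⊆ setD n := by
  rintro _ (((⟨hs, -⟩ | ⟨x, hx, rfl⟩) | ⟨p, hp, rfl⟩) | ⟨y, rfl⟩)
  exacts [hs, card_smul_ketBra_mem_setD hx, hp.kronecker_one_mem_setD, diagonalChoi_mem_setD y]

theorem choi_mem_setDTilde_of_map_single_eq_zero {φ : Matrix n n ℂ →ₗ[ℂ] Matrix n n ℂ}
    (hφ : IsPositiveMap φ) (hone : φ 1 = 1) {i : n}
    (hi : ∀ j ≠ i, φ (Matrix.single j j 1) = 0) : choi φ ∈ setDTilde n := by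
  have hsum : φ (Matrix.single i i 1) = 1 := by
    rw [← hone, ← Matrix.sum_single_one, map_sum, Fintype.sum_eq_single i hi]
  exact Or.inr ⟨_, isRankOneProjector_single i, by rw [hφ.choi_eq_single_kronecker hi, hsum]⟩

end Projector

/-! ### Extreme maps on the diagonal matrices -/

section DiagonalMap

variable {A : Matrix (Fin 2) (Fin 2) ℂ}

/-- The map `diag(d₀, d₁) ↦ d₀ A + d₁ (1 - A)`; every unital map on the diagonal matrices of `M_2`
has this form, where `A` is the image of `E₀₀`. -/
noncomputable def diagonalMap (A : Matrix (Fin 2) (Fin 2) ℂ) :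
    diagonalAlgebra (Fin 2) →ₗ[ℂ] Matrix (Fin 2) (Fin 2) ℂ :=
  ((Matrix.entryLinearMap ℂ ℂ 0 0).smulRight A + (Matrix.entryLinearMap ℂ ℂ 1 1).smulRight (1 - A))
    ∘ₗ (diagonalAlgebra (Fin 2)).val.toLinearMap

theorem diagonalMap_apply (d : diagonalAlgebra (Fin 2)) :
    diagonalMap A d = (d : Matrix (Fin 2) (Fin 2) ℂ) 0 0 • A +
      (d : Matrix (Fin 2) (Fin 2) ℂ) 1 1 • (1 - A) := rfl

theorem diagonalMap_injective : Function.Injective diagonalMap := fun A B h => by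
  have hsingle : Matrix.single 0 0 (1 : ℂ) ∈ diagonalAlgebra (Fin 2) :=
    ⟨Pi.single 0 1, Matrix.diagonal_single 0 1⟩
  simpa [diagonalMap_apply] using LinearMap.congr_fun h ⟨_, hsingle⟩

theorem diagonalMap_convexCombination (A B : Matrix (Fin 2) (Fin 2) ℂ) {s t : ℝ}
    (hst : s + t = 1) :
    diagonalMap (s • A + t • B) = s • diagonalMap A + t • diagonalMap B := by
  obtain rfl : t = 1 - s := by linarith
  ext1 d
  simp only [diagonalMap_apply, LinearMap.add_apply, LinearMap.smul_apply]
  module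

theorem diagonalMap_mem_diagonalMaps (hA : 0 ≤ A) (hA' : A ≤ 1) :
    diagonalMap A ∈ diagonalMaps (Fin 2) := by
  refine ⟨fun k X hX => ?_, by simp [diagonalMap_apply]⟩
  have h := ((hX.submatrix fun i : Fin k => (i, (0 : Fin 2))).kronecker
    (Matrix.nonneg_iff_posSemidef.mp hA)).add
    ((hX.submatrix fun i : Fin k => (i, (1 : Fin 2))).kronecker (Matrix.le_iff.mp hA'))
  refine (congrArg Matrix.PosSemidef ?_).mp h
  ext ⟨i, p⟩ ⟨j, q⟩
  simp [diagonalMap_apply, Matrix.kroneckerMap_apply]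

theorem comp_val_eq_diagonalMap {φ : Matrix (Fin 2) (Fin 2) ℂ →ₗ[ℂ] Matrix (Fin 2) (Fin 2) ℂ}
    (h : φ (Matrix.single 1 1 1) = 1 - φ (Matrix.single 0 0 1)) :
    φ ∘ₗ (diagonalAlgebra (Fin 2)).val.toLinearMap = diagonalMap (φ (Matrix.single 0 0 1)) := by
  ext1 ⟨a, d, rfl⟩
  rw [diagonalMap_apply, ← h]
  change φ (Matrix.diagonal d) = Matrix.diagonal d 0 0 • _ + Matrix.diagonal d 1 1 • _
  rw [map_eq_sum_single]
  simp [Fin.sum_univ_two]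

theorem isStarProjection_of_diagonalMap_mem_extremePoints (hA : 0 ≤ A) (hA' : A ≤ 1)
    (hext : diagonalMap A ∈ (diagonalMaps (Fin 2)).extremePoints ℝ) : IsStarProjection A := by
  have hmem (B : Matrix (Fin 2) (Fin 2) ℂ) :
      B ∈ {x : Matrix (Fin 2) (Fin 2) ℂ | 0 ≤ x} ∩ Metric.closedBall 0 1 ↔ 0 ≤ B ∧ B ≤ 1 := by
    rw [Set.mem_inter_iff, mem_closedBall_zero_iff]
    exact and_congr_right fun hB => CStarAlgebra.norm_le_one_iff_of_nonneg B hB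
  rw [isStarProjection_iff_mem_extremePoints_setOfPred_nonneg_inter_unitClosedBall,
    mem_extremePoints_iff_left]
  refine ⟨(hmem A).mpr ⟨hA, hA'⟩, fun B hB C hC hBC => diagonalMap_injective ?_⟩
  obtain ⟨s, t, hs, ht, hst, rfl⟩ := hBC
  rw [hmem] at hB hC
  exact (mem_extremePoints_iff_left.mp hext).2 _ (diagonalMap_mem_diagonalMaps hB.1 hB.2)
    _ (diagonalMap_mem_diagonalMaps hC.1 hC.2)
    ⟨s, t, hs, ht, hst, (diagonalMap_convexCombination B C hst).symm⟩

end DiagonalMap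

/-! ### Maps on `M_2` fixing the diagonal matrix units -/

section OffDiagonal

theorem mul_conj_eq_one_of_norm_eq_one {z : ℂ} (hz : ‖z‖ = 1) : z * starRingEnd ℂ z = 1 := by
  rw [RCLike.mul_conj, hz, RCLike.ofReal_one, one_pow]

theorem diagonal_mem_unitaryGroup {n : Type} [Fintype n] [DecidableEq n] {d : n → ℂ}
    (hd : ∀ i, ‖d i‖ = 1) : Matrix.diagonal d ∈ Matrix.unitaryGroup n ℂ := by
  have hd' : (fun i => d i * star d i) = 1 :=
    funext fun i => mul_conj_eq_one_of_norm_eq_one (hd i)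
  rw [Matrix.mem_unitaryGroup_iff, Matrix.star_eq_conjTranspose, Matrix.diagonal_conjTranspose,
    Matrix.diagonal_mul_diagonal, hd', Matrix.diagonal_one']

theorem exists_norm_mul_add_star_mul_eq (b c : ℂ) :
    ∃ z : ℂ, ‖z‖ = 1 ∧ ‖z * b + star z * c‖ = ‖b‖ + ‖c‖ := by
  let θ : ℝ := (c.arg - b.arg) / 2
  let μ : ℝ := (c.arg + b.arg) / 2
  have hb : Complex.exp (θ * Complex.I) * b = ‖b‖ * Complex.exp (μ * Complex.I) := by
    conv_lhs => rw [← Complex.norm_mul_exp_arg_mul_I b, mul_left_comm, ← Complex.exp_add]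
    congr 2
    push_cast [θ, μ]
    ring
  have hc : star (Complex.exp (θ * Complex.I)) * c = ‖c‖ * Complex.exp (μ * Complex.I) := by
    rw [Complex.star_def, ← Complex.exp_conj]
    conv_lhs => rw [← Complex.norm_mul_exp_arg_mul_I c, mul_left_comm, ← Complex.exp_add]
    congr 2
    simp only [map_mul, Complex.conj_ofReal, Complex.conj_I]
    push_cast [θ, μ]
    ring
  refine ⟨Complex.exp (θ * Complex.I), Complex.norm_exp_ofReal_mul_I θ, ?_⟩
  rw [hb, hc, ← add_mul, norm_mul, Complex.norm_exp_ofReal_mul_I, mul_one, ← Complex.ofReal_add,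
    Complex.norm_of_nonneg (by positivity)]

/-- The selfadjoint linear map on `M_2` which fixes `E₀₀` and `E₁₁` and maps `E₀₁` to
`b E₀₁ + c E₁₀`. -/
noncomputable def offDiagonalMap (b c : ℂ) :
    Matrix (Fin 2) (Fin 2) ℂ →ₗ[ℂ] Matrix (Fin 2) (Fin 2) ℂ where
  toFun a := !![a 0 0, a 0 1 * b + a 1 0 * star c; a 0 1 * c + a 1 0 * star b, a 1 1]
  map_add' a a' := by
    ext i j
    fin_cases i <;> fin_cases j <;> simp <;> ring
  map_smul' r a := by
    ext i j
    fin_cases i <;> fin_cases j <;> simp <;> ring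

theorem offDiagonalMap_apply (b c : ℂ) (a : Matrix (Fin 2) (Fin 2) ℂ) :
    offDiagonalMap b c a =
      !![a 0 0, a 0 1 * b + a 1 0 * star c; a 0 1 * c + a 1 0 * star b, a 1 1] := rfl

theorem offDiagonalMap_convexCombination (b c b' c' : ℂ) {s t : ℝ} (hst : s + t = 1) :
    offDiagonalMap (s • b + t • b') (s • c + t • c') =
      s • offDiagonalMap b c + t • offDiagonalMap b' c' := by
  obtain rfl : t = 1 - s := by linarith
  ext1 a
  ext i j
  fin_cases i <;> fin_cases j <;> simp [offDiagonalMap_apply] <;> ring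

theorem conjMap_diagonal {β : ℂ} (hβ : ‖β‖ = 1) :
    conjMap (Matrix.diagonal ![β, 1]) = offDiagonalMap β 0 := by
  ext1 a
  rw [conjMap_apply, offDiagonalMap_apply]
  ext i j
  fin_cases i <;> fin_cases j <;> simp
  · linear_combination a 0 0 * mul_conj_eq_one_of_norm_eq_one hβ
  · ring

theorem transposeConjMap_diagonal {γ : ℂ} (hγ : ‖γ‖ = 1) :
    transposeConjMap (Matrix.diagonal ![1, γ]) = offDiagonalMap 0 γ := by
  ext1 a
  rw [transposeConjMap_apply, offDiagonalMap_apply]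
  ext i j
  fin_cases i <;> fin_cases j <;> simp
  · ring
  · linear_combination a 1 1 * mul_conj_eq_one_of_norm_eq_one hγ

theorem IsPositiveMap.eq_offDiagonalMap
    {φ : Matrix (Fin 2) (Fin 2) ℂ →ₗ[ℂ] Matrix (Fin 2) (Fin 2) ℂ} (hφ : IsPositiveMap φ)
    (h₀ : φ (Matrix.single 0 0 1) = Matrix.single 0 0 1)
    (h₁ : φ (Matrix.single 1 1 1) = Matrix.single 1 1 1) :
    φ = offDiagonalMap (φ (Matrix.single 0 1 1) 0 1) (φ (Matrix.single 0 1 1) 1 0) := by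
  have h₀₀ : φ (Matrix.single 0 1 1) 0 0 = 0 :=
    hφ.map_single_apply_self_eq_zero (by simp [h₁]) 0
  have h₁₁ : φ (Matrix.single 0 1 1) 1 1 = 0 := by
    rw [hφ.map_single_swap 1 0, Matrix.conjTranspose_apply,
      hφ.map_single_apply_self_eq_zero (by simp [h₀]), star_zero]
  ext1 a
  rw [map_eq_sum_single φ a, offDiagonalMap_apply]
  ext i j
  fin_cases i <;> fin_cases j <;>
    simp [Fin.sum_univ_two, h₀, h₁, hφ.map_single_swap 0 1, h₀₀, h₁₁]

theorem norm_add_norm_le_one_of_isPositiveMap_offDiagonalMap {b c : ℂ}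
    (h : IsPositiveMap (offDiagonalMap b c)) : ‖b‖ + ‖c‖ ≤ 1 := by
  obtain ⟨z, hz, hnorm⟩ := exists_norm_mul_add_star_mul_eq b (star c)
  have hdet := (h _ (Matrix.posSemidef_vecMulVec_self_star ![z, 1])).det_nonneg
  have hdet' : (offDiagonalMap b c (Matrix.vecMulVec ![z, 1] (star ![z, 1]))).det =
      ((1 - ‖z * b + star z * star c‖ ^ 2 : ℝ) : ℂ) := by
    rw [offDiagonalMap_apply, Matrix.det_fin_two_of, Complex.ofReal_sub,
      ← Complex.normSq_eq_norm_sq, ← Complex.mul_conj]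
    simp [Matrix.vecMulVec_apply]
    linear_combination mul_conj_eq_one_of_norm_eq_one hz
  rw [hdet', Complex.zero_le_real, sub_nonneg, sq_le_one_iff₀ (norm_nonneg _), hnorm,
    norm_star] at hdet
  exact hdet

end OffDiagonal

/-! ### Convex combinations of unitary conjugations -/

section UnitaryHull

section General

variable {n : Type} [Fintype n] [DecidableEq n]

variable (n) in
/-- The conjugations `a ↦ u a u*` of `M_n` by unitaries, i.e. its automorphisms. -/
def unitaryConjugations : Set (Matrix n n ℂ →ₗ[ℂ] Matrix n n ℂ) :=
  conjMap '' Matrix.unitaryGroup n ℂ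

variable (n) in
/-- The maps `a ↦ u aᵀ u*` with `u` unitary, i.e. the anti-automorphisms of `M_n`. -/
def transposedUnitaryConjugations : Set (Matrix n n ℂ →ₗ[ℂ] Matrix n n ℂ) :=
  transposeConjMap '' Matrix.unitaryGroup n ℂ

theorem conjMap_comp_conjMap (u v : Matrix n n ℂ) : conjMap u ∘ₗ conjMap v = conjMap (u * v) := by
  ext1 a
  simp only [LinearMap.comp_apply, conjMap_apply, Matrix.conjTranspose_mul, mul_assoc]

theorem conjMap_one : conjMap (1 : Matrix n n ℂ) = LinearMap.id := by
  ext1 a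
  simp [conjMap_apply]

theorem conjMap_comp_mem_unitaryConjugations {u : Matrix n n ℂ}
    (hu : u ∈ Matrix.unitaryGroup n ℂ) {φ : Matrix n n ℂ →ₗ[ℂ] Matrix n n ℂ}
    (hφ : φ ∈ unitaryConjugations n) : conjMap u ∘ₗ φ ∈ unitaryConjugations n := by
  obtain ⟨v, hv, rfl⟩ := hφ
  exact ⟨u * v, mul_mem hu hv, (conjMap_comp_conjMap u v).symm⟩

theorem conjMap_comp_mem_transposedUnitaryConjugations {u : Matrix n n ℂ}
    (hu : u ∈ Matrix.unitaryGroup n ℂ) {φ : Matrix n n ℂ →ₗ[ℂ] Matrix n n ℂ}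
    (hφ : φ ∈ transposedUnitaryConjugations n) :
    conjMap u ∘ₗ φ ∈ transposedUnitaryConjugations n := by
  obtain ⟨v, hv, rfl⟩ := hφ
  refine ⟨u * v, mul_mem hu hv, ?_⟩
  rw [transposeConjMap, transposeConjMap, ← LinearMap.comp_assoc, conjMap_comp_conjMap]

theorem conjMap_conjTranspose_comp_apply {v : Matrix n n ℂ} (hv : v ∈ Matrix.unitaryGroup n ℂ)
    {φ : Matrix n n ℂ →ₗ[ℂ] Matrix n n ℂ} {a : Matrix n n ℂ} (ha : φ a = conjMap v a) :
    (conjMap vᴴ ∘ₗ φ) a = a := by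
  have hv' : vᴴ * v = 1 := Matrix.mem_unitaryGroup_iff'.mp hv
  rw [LinearMap.comp_apply, ha, ← LinearMap.comp_apply, conjMap_comp_conjMap, hv', conjMap_one,
    LinearMap.id_apply]

theorem unitaryConjugations_subset_completelyPositiveMaps [Nonempty n] :
    unitaryConjugations n ⊆ completelyPositiveMaps n :=
  Set.image_subset_iff.mpr fun _ => conjMap_mem_completelyPositiveMaps

theorem unitaryConjugations_subset_positiveMaps [Nonempty n] :
    unitaryConjugations n ⊆ positiveMaps n :=
  unitaryConjugations_subset_completelyPositiveMaps.trans completelyPositiveMaps_subset_positiveMaps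

theorem transposedUnitaryConjugations_subset_positiveMaps [Nonempty n] :
    transposedUnitaryConjugations n ⊆ positiveMaps n :=
  Set.image_subset_iff.mpr fun _ => transposeConjMap_mem_positiveMaps

theorem comp_mem_convexHull {E F : Type*} [AddCommGroup E] [Module ℂ E]
    [AddCommGroup F] [Module ℂ F] {f : F →ₗ[ℂ] F} {S : Set (E →ₗ[ℂ] F)}
    (hf : ∀ φ ∈ S, f ∘ₗ φ ∈ S) {φ : E →ₗ[ℂ] F} (hφ : φ ∈ convexHull ℝ S) :
    f ∘ₗ φ ∈ convexHull ℝ S := by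
  have hlinear : IsLinearMap ℝ fun ψ : E →ₗ[ℂ] F => f ∘ₗ ψ :=
    ⟨fun _ _ => LinearMap.comp_add _ _ _, fun r ψ => by ext; simp⟩
  have hconvex := (convex_convexHull ℝ S).is_linear_preimage hlinear
  exact convexHull_min (t := {ψ | f ∘ₗ ψ ∈ convexHull ℝ S})
    (fun ψ hψ => subset_convexHull ℝ S (hf ψ hψ)) hconvex hφ

theorem mem_convexHull_of_conjMap_conjTranspose_comp_mem {v : Matrix n n ℂ}
    (hv : v ∈ Matrix.unitaryGroup n ℂ) {S : Set (Matrix n n ℂ →ₗ[ℂ] Matrix n n ℂ)}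
    (hS : ∀ ψ ∈ S, conjMap v ∘ₗ ψ ∈ S) {φ : Matrix n n ℂ →ₗ[ℂ] Matrix n n ℂ}
    (hφ : conjMap vᴴ ∘ₗ φ ∈ convexHull ℝ S) : φ ∈ convexHull ℝ S := by
  have hv' : v * vᴴ = 1 := Matrix.mem_unitaryGroup_iff.mp hv
  have h := comp_mem_convexHull hS hφ
  rwa [← LinearMap.comp_assoc, conjMap_comp_conjMap, hv', conjMap_one, LinearMap.id_comp] at h

end General

section FinTwo

variable {b c : ℂ} {v : Matrix (Fin 2) (Fin 2) ℂ}
  {φ : Matrix (Fin 2) (Fin 2) ℂ →ₗ[ℂ] Matrix (Fin 2) (Fin 2) ℂ}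

theorem offDiagonalMap_zero_right_mem_convexHull (hb : ‖b‖ ≤ 1) :
    offDiagonalMap b 0 ∈ convexHull ℝ (unitaryConjugations (Fin 2)) := by
  have hconvex : Convex ℝ {b | offDiagonalMap b 0 ∈ convexHull ℝ (unitaryConjugations (Fin 2))} :=
    fun b hb b' hb' s t hs ht hst => by
      have h := offDiagonalMap_convexCombination b 0 b' 0 hst
      rw [smul_zero, smul_zero, add_zero] at h
      rw [Set.mem_ofPred_eq, h]
      exact convex_convexHull ℝ _ hb hb' hs ht hst
  rw [← mem_closedBall_zero_iff, ← convexHull_sphere_eq_closedBall 0 zero_le_one] at hb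
  refine convexHull_min (fun β hβ => ?_) hconvex hb
  rw [mem_sphere_zero_iff_norm] at hβ
  exact subset_convexHull ℝ _ ⟨_, diagonal_mem_unitaryGroup (by simp [Fin.forall_fin_two, hβ]),
    conjMap_diagonal hβ⟩

theorem offDiagonalMap_zero_left_mem_convexHull (hc : ‖c‖ ≤ 1) :
    offDiagonalMap 0 c ∈ convexHull ℝ (transposedUnitaryConjugations (Fin 2)) := by
  have hconvex :
      Convex ℝ {c | offDiagonalMap 0 c ∈ convexHull ℝ (transposedUnitaryConjugations (Fin 2))} :=
    fun c hc c' hc' s t hs ht hst => by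
      have h := offDiagonalMap_convexCombination 0 c 0 c' hst
      rw [smul_zero, smul_zero, add_zero] at h
      rw [Set.mem_ofPred_eq, h]
      exact convex_convexHull ℝ _ hc hc' hs ht hst
  rw [← mem_closedBall_zero_iff, ← convexHull_sphere_eq_closedBall 0 zero_le_one] at hc
  refine convexHull_min (fun γ hγ => ?_) hconvex hc
  rw [mem_sphere_zero_iff_norm] at hγ
  exact subset_convexHull ℝ _ ⟨_, diagonal_mem_unitaryGroup (by simp [Fin.forall_fin_two, hγ]),
    transposeConjMap_diagonal hγ⟩

theorem offDiagonalMap_mem_convexHull (hbc : ‖b‖ + ‖c‖ ≤ 1) :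
    offDiagonalMap b c ∈ convexHull ℝ
      (unitaryConjugations (Fin 2) ∪ transposedUnitaryConjugations (Fin 2)) := by
  have hs : 0 ≤ 1 - ‖c‖ := by linarith [norm_nonneg b]
  have hb : (1 - ‖c‖) • ((1 - ‖c‖)⁻¹ • b) = b := by
    rcases hs.eq_or_lt with hs0 | hs0
    · rw [← hs0, zero_smul, norm_le_zero_iff.mp (by linarith : ‖b‖ ≤ 0)]
    · exact smul_inv_smul₀ hs0.ne' b
  have hc : ‖c‖ • (‖c‖⁻¹ • c) = c := by
    rcases eq_or_ne c 0 with rfl | hc0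
    · simp
    · exact smul_inv_smul₀ (norm_ne_zero_iff.mpr hc0) c
  have hb' : ‖(1 - ‖c‖)⁻¹ • b‖ ≤ 1 := by
    rw [norm_smul, norm_inv, Real.norm_of_nonneg hs, inv_mul_eq_div]
    exact div_le_one_of_le₀ (by linarith) hs
  have hc' : ‖‖c‖⁻¹ • c‖ ≤ 1 := by
    rw [norm_smul, norm_inv, norm_norm, inv_mul_eq_div]
    exact div_self_le_one _
  have hcomb := offDiagonalMap_convexCombination ((1 - ‖c‖)⁻¹ • b) 0 0 (‖c‖⁻¹ • c)
    (sub_add_cancel 1 ‖c‖)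
  rw [smul_zero, smul_zero, add_zero, zero_add, hb, hc] at hcomb
  rw [hcomb]
  exact convex_convexHull ℝ _
    (convexHull_mono Set.subset_union_left (offDiagonalMap_zero_right_mem_convexHull hb'))
    (convexHull_mono Set.subset_union_right (offDiagonalMap_zero_left_mem_convexHull hc'))
    hs (norm_nonneg c) (sub_add_cancel 1 ‖c‖)

theorem IsPositiveMap.mem_convexHull_of_map_single_eq_self (hφ : IsPositiveMap φ)
    (h₀ : φ (Matrix.single 0 0 1) = Matrix.single 0 0 1)
    (h₁ : φ (Matrix.single 1 1 1) = Matrix.single 1 1 1) :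
    φ ∈ convexHull ℝ (unitaryConjugations (Fin 2) ∪ transposedUnitaryConjugations (Fin 2)) := by
  have heq := hφ.eq_offDiagonalMap h₀ h₁
  rw [heq] at hφ ⊢
  exact offDiagonalMap_mem_convexHull (norm_add_norm_le_one_of_isPositiveMap_offDiagonalMap hφ)

theorem IsCompletelyPositive.mem_convexHull_of_map_single_eq_self (hφ : IsCompletelyPositive φ)
    (h₀ : φ (Matrix.single 0 0 1) = Matrix.single 0 0 1)
    (h₁ : φ (Matrix.single 1 1 1) = Matrix.single 1 1 1) :
    φ ∈ convexHull ℝ (unitaryConjugations (Fin 2)) := by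
  have hpos := hφ.isPositiveMap
  have heq := hpos.eq_offDiagonalMap h₀ h₁
  rw [hφ.map_single_apply_eq_zero (by simp [h₁]) 0 1] at heq
  rw [heq] at hpos ⊢
  have hle := norm_add_norm_le_one_of_isPositiveMap_offDiagonalMap hpos
  rw [norm_zero, add_zero] at hle
  exact offDiagonalMap_zero_right_mem_convexHull hle

theorem IsPositiveMap.mem_convexHull_of_map_single_eq_conjMap (hφ : IsPositiveMap φ)
    (hv : v ∈ Matrix.unitaryGroup (Fin 2) ℂ)
    (h₀ : φ (Matrix.single 0 0 1) = conjMap v (Matrix.single 0 0 1))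
    (h₁ : φ (Matrix.single 1 1 1) = conjMap v (Matrix.single 1 1 1)) :
    φ ∈ convexHull ℝ (unitaryConjugations (Fin 2) ∪ transposedUnitaryConjugations (Fin 2)) := by
  have hcomp : IsPositiveMap (conjMap vᴴ ∘ₗ φ) := fun a ha =>
    (isCompletelyPositive_conjMap vᴴ).isPositiveMap _ (hφ a ha)
  refine mem_convexHull_of_conjMap_conjTranspose_comp_mem hv ?_
    (hcomp.mem_convexHull_of_map_single_eq_self (conjMap_conjTranspose_comp_apply hv h₀)
      (conjMap_conjTranspose_comp_apply hv h₁))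
  exact fun ψ => Or.imp (conjMap_comp_mem_unitaryConjugations hv)
    (conjMap_comp_mem_transposedUnitaryConjugations hv)

theorem IsCompletelyPositive.mem_convexHull_of_map_single_eq_conjMap (hφ : IsCompletelyPositive φ)
    (hv : v ∈ Matrix.unitaryGroup (Fin 2) ℂ)
    (h₀ : φ (Matrix.single 0 0 1) = conjMap v (Matrix.single 0 0 1))
    (h₁ : φ (Matrix.single 1 1 1) = conjMap v (Matrix.single 1 1 1)) :
    φ ∈ convexHull ℝ (unitaryConjugations (Fin 2)) := by
  have hcomp : IsCompletelyPositive (conjMap vᴴ ∘ₗ φ) := fun k A hA =>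
    isCompletelyPositive_conjMap vᴴ k _ (hφ k A hA)
  exact mem_convexHull_of_conjMap_conjTranspose_comp_mem hv
    (fun ψ => conjMap_comp_mem_unitaryConjugations hv)
    (hcomp.mem_convexHull_of_map_single_eq_self (conjMap_conjTranspose_comp_apply hv h₀)
      (conjMap_conjTranspose_comp_apply hv h₁))

theorem choi_mem_setDTilde_of_map_single_eq_conjMap
    (hφ : φ ∈ (positiveMaps (Fin 2)).extremePoints ℝ ∨
      φ ∈ (completelyPositiveMaps (Fin 2)).extremePoints ℝ)
    (hv : v ∈ Matrix.unitaryGroup (Fin 2) ℂ)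
    (h₀ : φ (Matrix.single 0 0 1) = conjMap v (Matrix.single 0 0 1))
    (h₁ : φ (Matrix.single 1 1 1) = conjMap v (Matrix.single 1 1 1)) :
    choi φ ∈ setDTilde (Fin 2) := by
  rcases hφ with hext | hext
  · have hhull := hext.1.1.mem_convexHull_of_map_single_eq_conjMap hv h₀ h₁
    obtain ⟨u, hu, rfl⟩ | ⟨u, hu, rfl⟩ := mem_of_mem_extremePoints_of_mem_convexHull
      convex_positiveMaps (Set.union_subset unitaryConjugations_subset_positiveMaps
        transposedUnitaryConjugations_subset_positiveMaps) hext hhull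
    exacts [choi_conjMap_mem_setDTilde hu, choi_transposeConjMap_mem_setDTilde hu]
  · have hhull := hext.1.1.mem_convexHull_of_map_single_eq_conjMap hv h₀ h₁
    obtain ⟨u, hu, rfl⟩ := mem_of_mem_extremePoints_of_mem_convexHull
      convex_completelyPositiveMaps unitaryConjugations_subset_completelyPositiveMaps hext hhull
    exact choi_conjMap_mem_setDTilde hu

theorem IsRegularExtreme.choi_mem_setDTilde (hφ : IsRegularExtreme φ) :
    choi φ ∈ setDTilde (Fin 2) := by
  obtain ⟨hext, hdiag⟩ := hφ
  obtain ⟨hpos, hone, -⟩ : φ ∈ positiveMaps (Fin 2) :=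
    hext.elim And.left fun h => completelyPositiveMaps_subset_positiveMaps h.1
  have hsum : Matrix.single 1 1 (1 : ℂ) = 1 - Matrix.single (0 : Fin 2) (0 : Fin 2) 1 := by
    rw [← Matrix.sum_single_one, Fin.sum_univ_two, add_sub_cancel_left]
  have hφ₁ : φ (Matrix.single 1 1 1) = 1 - φ (Matrix.single 0 0 1) := by
    rw [hsum, map_sub, hone]
  have hnonneg : 0 ≤ φ (Matrix.single 0 0 1) := (hpos _ (posSemidef_single 0)).nonneg
  have hle : φ (Matrix.single 0 0 1) ≤ 1 := by
    rw [← sub_nonneg, ← hφ₁]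
    exact (hpos _ (posSemidef_single 1)).nonneg
  rw [comp_val_eq_diagonalMap hφ₁] at hdiag
  rcases isStarProjection_fin_two
    (isStarProjection_of_diagonalMap_mem_extremePoints hnonneg hle hdiag) with
    hzero | hone' | ⟨v, hv, hrank⟩
  · exact choi_mem_setDTilde_of_map_single_eq_zero hpos hone (i := 1)
      (by simpa [Fin.forall_fin_two] using hzero)
  · exact choi_mem_setDTilde_of_map_single_eq_zero hpos hone (i := 0)
      (by simp [Fin.forall_fin_two, hφ₁, hone'])
  · refine choi_mem_setDTilde_of_map_single_eq_conjMap hext hv hrank ?_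
    rw [hφ₁, hrank, hsum, map_sub, (conjMap_mem_positiveMaps hv).2.1, conjMap_apply]

end FinTwo

end UnitaryHull

end RegularExtreme

theorem mainTheorem2_general :
    (∀ (n : Type) [Fintype n] [DecidableEq n] [Nonempty n],
      RegularExtreme.setDTilde n ∪ Set.range (RegularExtreme.diagonalChoi (n := n)) ⊆
        RegularExtreme.setD n) ∧
    ∀ φ : Matrix (Fin 2) (Fin 2) ℂ →ₗ[ℂ] Matrix (Fin 2) (Fin 2) ℂ,
      RegularExtreme.IsRegularExtreme φ →
        RegularExtreme.choi φ ∈ RegularExtreme.setDTilde (Fin 2) :=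
  ⟨fun _ _ _ _ => RegularExtreme.setDTilde_union_range_diagonalChoi_subset_setD,
    fun _ hφ => hφ.choi_mem_setDTilde⟩

theorem mainTheorem2 :
    (RegularExtreme.setDTilde (Fin 2) ∪ Set.range (RegularExtreme.diagonalChoi (n := Fin 2)) ⊆
      RegularExtreme.setD (Fin 2)) ∧
    ∀ φ : Matrix (Fin 2) (Fin 2) ℂ →ₗ[ℂ] Matrix (Fin 2) (Fin 2) ℂ,
      RegularExtreme.IsRegularExtreme φ →
        RegularExtreme.choi φ ∈
          RegularExtreme.setDTilde (Fin 2) ∪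
            Set.range (RegularExtreme.diagonalChoi (n := Fin 2)) :=
  ⟨mainTheorem2_general.1 (Fin 2), fun φ hφ => Or.inl (mainTheorem2_general.2 φ hφ)⟩
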